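/- A bumpless pipe dream (BPD) of size $n$ is a tiling of the $n\times n$ square grid by the six tiles: empty, cross (a vertical and a horizontal pipe crossing), horizontal, vertical, r-elbow (joining the south and east sides) and j-elbow (joining the west and north sides), such that neighbouring tiles match along their common side, a pipe enters through the south side of every column, a pipe leaves through the east side of every row, and no pipe touches the north or west side of the square. Its pipes travel upwards and to the right. It is reduced (an RBPD) if every two distinct pipes cross at most once. A $2\times 2$ flip replaces the four tiles of a $2\times 2$ window of a BPD by a different valid tiling of the window with the same boundary conditions. Explicitly, a flip or its inverse makes one of the two replacements (empty $\to$ r-elbow, j-elbow $\to$ cross) in the NW cell, one of (r-elbow $\to$ horizontal, vertical $\to$ j-elbow) in the NE cell, one of (horizontal $\to$ j-elbow, r-elbow $\to$ vertical) in the SW cell, and one of (j-elbow $\to$ empty, cross $\to$ r-elbow) in the SE cell. Let $R$ be a rectangle of cells with at least two rows and two columns in a BPD, whose NW corner is an r-elbow, whose SE corner is empty, and which has no elbows except possibly at its four corners. The droop at $R$ makes the NW corner empty, the SE corner a j-elbow, and the NE and SW corners r-elbows. On the north border (corners excluded) horizontal tiles become empty and crosses become vertical; on the west border vertical tiles become empty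 and crosses become horizontal; on the south border empty tiles become horizontal and vertical tiles become crosses; on the east border empty tiles become vertical and horizontal tiles become crosses. All other tiles are unchanged. A droop is permitted only if its result is again a BPD. An undroop is the inverse of a droop. Theorem. For every $n$, the set of all $n\times n$ RBPDs is connected under $2\times 2$ flips that preserve reducedness, together with droops and undroops: the graph whose vertices are the $n\times n$ RBPDs, two distinct ones being adjacent when they are related by a $2\times 2$ flip, a droop or an undroop, is connected. -/

import Mathlib

/-- The six tiles of a bumpless pipe dream. Pipes travel upwards and to the right. -/
inductive Tile where
  /-- the empty tile -/
  | blank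
  /-- two pipes, one vertical and one horizontal, cross -/
  | cross
  /-- a horizontal segment joining the west and east sides -/
  | horiz
  /-- a vertical segment joining the south and north sides -/
  | vert
  /-- an r-elbow, joining the south and east sides -/
  | relbow
  /-- a j-elbow, joining the west and north sides -/
  | jelbow
  deriving DecidableEq

namespace Tile

/-- A pipe passes through the north side of the tile. -/
def north : Tile → Bool
  | cross => true
  | vert => true
  | jelbow => true
  | _ => false

/-- A pipe passes through the south side of the tile. -/
def south : Tile → Bool
  | cross => true
  | vert => true
  | relbow => true
  | _ => false

/-- A pipe passes through the west side of the tile. -/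
def west : Tile → Bool
  | cross => true
  | horiz => true
  | jelbow => true
  | _ => false

/-- A pipe passes through the east side of the tile. -/
def east : Tile → Bool
  | cross => true
  | horiz => true
  | relbow => true
  | _ => false

/-- The tile is an elbow (of either kind). -/
def IsElbow (t : Tile) : Prop := t = relbow ∨ t = jelbow

end Tile

/-- An `n × n` bumpless pipe dream: `tile i j` is the tile in row `i` (rows numbered from the top)
and column `j` (columns numbered from the left). Neighbouring tiles match along their common side,
a pipe enters through the south side of every column, a pipe leaves through the east side of every
row, and no pipe touches the north or the west side of the square. -/
@[ext]
structure BPD (n : ℕ) where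
  tile : Fin n → Fin n → Tile
  match_horizontal : ∀ i j j' : Fin n, (j' : ℕ) = j + 1 → (tile i j).east = (tile i j').west
  match_vertical : ∀ i i' j : Fin n, (i' : ℕ) = i + 1 → (tile i j).south = (tile i' j).north
  boundary_west : ∀ i j : Fin n, (j : ℕ) = 0 → (tile i j).west = false
  boundary_east : ∀ i j : Fin n, (j : ℕ) + 1 = n → (tile i j).east = true
  boundary_north : ∀ i j : Fin n, (i : ℕ) = 0 → (tile i j).north = false
  boundary_south : ∀ i j : Fin n, (i : ℕ) + 1 = n → (tile i j).south = true

/-- The direction in which a pipe is travelling. A pipe heading `up` enters a tile through its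
south side, or leaves it through its north side; a pipe heading `right` enters a tile through its
west side, or leaves it through its east side. -/
inductive Heading where
  | up
  | right
  deriving DecidableEq

/-- The heading with which a pipe leaves a tile, given the heading with which it enters it
(`none` if the tile has no pipe entering with that heading). -/
def Tile.exit : Tile → Heading → Option Heading
  | cross, h => some h
  | vert, .up => some .up
  | horiz, .right => some .right
  | relbow, .up => some .right
  | jelbow, .right => some .up
  | _, _ => none

namespace BPD

variable {n : ℕ}

/-- `D.Visits p i j h`: the pipe that starts at the south side of the square in column `p` enters
the tile `(i, j)` with heading `h`. -/
inductive Visits (D : BPD n) (p : Fin n) : Fin n → Fin n → Heading → Prop where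
  | start (i : Fin n) (hi : (i : ℕ) + 1 = n) : Visits D p i p .up
  | up (i i' j : Fin n) (h : Heading) (hv : Visits D p i j h)
      (he : (D.tile i j).exit h = some .up) (hi : (i' : ℕ) + 1 = i) : Visits D p i' j .up
  | right (i j j' : Fin n) (h : Heading) (hv : Visits D p i j h)
      (he : (D.tile i j).exit h = some .right) (hj : (j' : ℕ) = j + 1) : Visits D p i j' .right

/-- The pipes `p` and `q` cross each other at the tile `c`, given as (row, column). -/
def CrossAt (D : BPD n) (p q : Fin n) (c : Fin n × Fin n) : Prop :=
  D.tile c.1 c.2 = .cross ∧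
    ((D.Visits p c.1 c.2 .up ∧ D.Visits q c.1 c.2 .right) ∨
      (D.Visits q c.1 c.2 .up ∧ D.Visits p c.1 c.2 .right))

/-- A bumpless pipe dream is reduced if every two distinct pipes cross at most once. -/
def IsReduced (D : BPD n) : Prop :=
  ∀ p q : Fin n, p ≠ q → {c : Fin n × Fin n | D.CrossAt p q c}.Subsingleton

/-- `D'` arises from `D` by replacing the four tiles of a `2 × 2` window, in rows `i`, `i + 1` and
columns `j`, `j + 1`, as follows (the choices in the four cells being independent of each other,
this gives 16 replacements of windows):
NW: empty to r-elbow, or j-elbow to cross;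
NE: r-elbow to horizontal, or vertical to j-elbow;
SW: horizontal to j-elbow, or r-elbow to vertical;
SE: j-elbow to empty, or cross to r-elbow.
All tiles outside the window are unchanged. -/
def UpFlip (D D' : BPD n) : Prop :=
  ∃ i i' j j' : Fin n, (i' : ℕ) = i + 1 ∧ (j' : ℕ) = j + 1 ∧
    ((D.tile i j = .blank ∧ D'.tile i j = .relbow) ∨
      (D.tile i j = .jelbow ∧ D'.tile i j = .cross)) ∧
    ((D.tile i j' = .relbow ∧ D'.tile i j' = .horiz) ∨
      (D.tile i j' = .vert ∧ D'.tile i j' = .jelbow)) ∧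
    ((D.tile i' j = .horiz ∧ D'.tile i' j = .jelbow) ∨
      (D.tile i' j = .relbow ∧ D'.tile i' j = .vert)) ∧
    ((D.tile i' j' = .jelbow ∧ D'.tile i' j' = .blank) ∨
      (D.tile i' j' = .cross ∧ D'.tile i' j' = .relbow)) ∧
    ∀ k l : Fin n, ¬((k = i ∨ k = i') ∧ (l = j ∨ l = j')) → D'.tile k l = D.tile k l

/-- The bumpless pipe dreams `D` and `D'` are related by a `2 × 2` flip. -/
def Flip (D D' : BPD n) : Prop := D.UpFlip D' ∨ D'.UpFlip D

end BPD

/-- `t'` is obtained from `t` by adding a horizontal segment. -/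
def Tile.AddHoriz (t t' : Tile) : Prop :=
  (t = .blank ∧ t' = .horiz) ∨ (t = .vert ∧ t' = .cross)

/-- `t'` is obtained from `t` by adding a vertical segment. -/
def Tile.AddVert (t t' : Tile) : Prop :=
  (t = .blank ∧ t' = .vert) ∨ (t = .horiz ∧ t' = .cross)

namespace BPD

variable {n : ℕ}

/-- `D'` is obtained from `D` by the droop at the rectangle with rows `i₁, …, i₂` and columns
`j₁, …, j₂`. -/
structure DroopAt (D D' : BPD n) (i₁ i₂ j₁ j₂ : Fin n) : Prop where
  rows_lt : i₁ < i₂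
  cols_lt : j₁ < j₂
  /-- the rectangle is droopable -/
  nw_before : D.tile i₁ j₁ = .relbow
  se_before : D.tile i₂ j₂ = .blank
  no_elbow : ∀ i j, i₁ ≤ i → i ≤ i₂ → j₁ ≤ j → j ≤ j₂ →
    ¬((i = i₁ ∨ i = i₂) ∧ (j = j₁ ∨ j = j₂)) → ¬(D.tile i j).IsElbow
  /-- the new corners -/
  nw_after : D'.tile i₁ j₁ = .blank
  se_after : D'.tile i₂ j₂ = .jelbow
  ne_after : D'.tile i₁ j₂ = .relbow
  sw_after : D'.tile i₂ j₁ = .relbow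
  /-- the north and west borders retract -/
  north_border : ∀ j, j₁ < j → j < j₂ → (D'.tile i₁ j).AddHoriz (D.tile i₁ j)
  west_border : ∀ i, i₁ < i → i < i₂ → (D'.tile i j₁).AddVert (D.tile i j₁)
  /-- the south and east borders extend -/
  south_border : ∀ j, j₁ < j → j < j₂ → (D.tile i₂ j).AddHoriz (D'.tile i₂ j)
  east_border : ∀ i, i₁ < i → i < i₂ → (D.tile i j₂).AddVert (D'.tile i j₂)
  /-- the interior of the rectangle is unchanged -/
  interior : ∀ i j, i₁ < i → i < i₂ → j₁ < j → j < j₂ → D'.tile i j = D.tile i j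
  /-- the tiles outside the rectangle are unchanged -/
  outside : ∀ i j, ¬(i₁ ≤ i ∧ i ≤ i₂ ∧ j₁ ≤ j ∧ j ≤ j₂) → D'.tile i j = D.tile i j

/-- `D'` is obtained from `D` by a droop. -/
def Droop (D D' : BPD n) : Prop := ∃ i₁ i₂ j₁ j₂ : Fin n, D.DroopAt D' i₁ i₂ j₁ j₂

/-- `D'` is obtained from `D` by an undroop, the inverse of a droop. -/
def Undroop (D D' : BPD n) : Prop := D'.Droop D

end BPD

/-- The reduced bumpless pipe dreams of size `n`. -/
def RBPD (n : ℕ) : Type := {D : BPD n // D.IsReduced}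

/-- The graph whose vertices are the reduced bumpless pipe dreams of size `n` and whose edges are
the `2 × 2` flips between reduced bumpless pipe dreams, the droops and the undroops. -/
def rbpdGraph (n : ℕ) : SimpleGraph (RBPD n) :=
  SimpleGraph.fromRel fun D D' =>
    BPD.Flip D.1 D'.1 ∨ BPD.Droop D.1 D'.1 ∨ BPD.Undroop D.1 D'.1

/-!
Every reduced bumpless pipe dream is joined to the identity, the dream whose only elbows are
r-elbows on the diagonal. Both kinds of moves that are used are instances of one operation: toggling
a rectangle (`BPD.Movable.move`), which shifts pipe segments from its south and east borders to its
north and west borders. Such a toggle shifts horizontal segments to smaller row numbers, so it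
decreases `BPD.depth`, the sum of the row numbers of all horizontal adjacencies. It therefore
suffices that every dream other than the identity admits such a toggle with a reduced result
(`BPD.IsReduced.exists_move`). There are three cases.

* There is a j-elbow. Take one that has no other j-elbow to its northwest, and follow its pipe `p`
  backwards to the nearest r-elbow in its row and forwards to the nearest one in its column. The
  rectangle spanned contains no further elbow: from an r-elbow inside it another pipe would run
  straight down and straight right, and cross `p` on both sides. So the dream can be undrooped
  (`BPD.IsReduced.exists_undroop`). The undroop moves `p` alone, and every pipe that passes straight
  through the rectangle crosses `p` once before and once after it; `BPD.Movable.oldCross` injects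
  the crossings after the undroop into those before it, so the result is reduced.
* There is no j-elbow, but an empty tile. Then the `2 × 2` flip at a suitable empty tile removes a
  crossing (`BPD.exists_upFlip`). The result has at most two j-elbows, and `BPD.isReduced_of_forall`
  and `BPD.isReduced_of_two_jelbows` show that it is reduced: of two pipes that cross twice, the one
  heading right at the first crossing has to turn up at a j-elbow between the two crossings, which
  confines the second crossing to a place that the other pipe does not pass vertically.
* There is neither a j-elbow nor an empty tile. Then every tile is determined by its northern and
  western neighbours, and the dream is the identity (`BPD.eq_of_no_blank_of_no_jelbow`).
-/

open Relation

/-! ### Sides of tiles -/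

namespace Tile

/-- A tile is determined by the sides that its pipes pass through. -/
theorem ext_sides {t t' : Tile} (hn : t.north = t'.north) (hs : t.south = t'.south)
    (hw : t.west = t'.west) (he : t.east = t'.east) : t = t' := by
  cases t <;> cases t' <;> simp_all [north, south, west, east]

theorem eq_blank_iff {t : Tile} : t = blank ↔
    t.north = false ∧ t.south = false ∧ t.west = false ∧ t.east = false := by
  cases t <;> simp [north, south, west, east]

theorem eq_cross_iff {t : Tile} : t = cross ↔
    t.north = true ∧ t.south = true ∧ t.west = true ∧ t.east = true := by
  cases t <;> simp [north, south, west, east]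

theorem eq_relbow_iff {t : Tile} : t = relbow ↔ t.south = true ∧ t.north = false := by
  cases t <;> simp [north, south]

theorem eq_relbow_iff' {t : Tile} : t = relbow ↔ t.east = true ∧ t.west = false := by
  cases t <;> simp [west, east]

theorem eq_jelbow_iff {t : Tile} : t = jelbow ↔ t.north = true ∧ t.south = false := by
  cases t <;> simp [north, south]

theorem eq_jelbow_iff' {t : Tile} : t = jelbow ↔ t.west = true ∧ t.east = false := by
  cases t <;> simp [west, east]

/-- A tile without an elbow passes its horizontal and its vertical pipe straight through. -/
theorem not_isElbow_iff {t : Tile} : ¬ t.IsElbow ↔ t.north = t.south ∧ t.west = t.east := by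
  cases t <;> simp [IsElbow, north, south, west, east]

theorem exit_up_eq_up {t : Tile} :
    t.exit .up = some .up ↔ t.south = true ∧ t.north = true := by
  cases t <;> simp [exit, north, south]

theorem exit_up_eq_right {t : Tile} :
    t.exit .up = some .right ↔ t.south = true ∧ t.north = false := by
  cases t <;> simp [exit, north, south]

theorem exit_right_eq_right {t : Tile} :
    t.exit .right = some .right ↔ t.west = true ∧ t.east = true := by
  cases t <;> simp [exit, west, east]

theorem exit_right_eq_up {t : Tile} :
    t.exit .right = some .up ↔ t.west = true ∧ t.east = false := by
  cases t <;> simp [exit, west, east]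

theorem north_of_exit {t : Tile} {h : Heading} (he : t.exit h = some .up) : t.north = true := by
  cases t <;> cases h <;> simp_all [exit, north]

theorem east_of_exit {t : Tile} {h : Heading} (he : t.exit h = some .right) : t.east = true := by
  cases t <;> cases h <;> simp_all [exit, east]

theorem addHoriz_of_sides {t t' : Tile} (hn : t'.north = t.north) (hs : t'.south = t.south)
    (hw : t.west = false) (he : t.east = false) (hw' : t'.west = true) (he' : t'.east = true) :
    t.AddHoriz t' := by
  cases t <;> cases t' <;> simp_all [north, south, west, east, AddHoriz]

theorem addVert_of_sides {t t' : Tile} (hw : t'.west = t.west) (he : t'.east = t.east)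
    (hn : t.north = false) (hs : t.south = false) (hn' : t'.north = true) (hs' : t'.south = true) :
    t.AddVert t' := by
  cases t <;> cases t' <;> simp_all [north, south, west, east, AddVert]

/-- The tile whose pipes pass through the given sides (the empty tile if there is none). -/
def ofSides : (north south west east : Bool) → Tile
  | true, true, true, true => cross
  | false, false, true, true => horiz
  | true, true, false, false => vert
  | false, true, false, true => relbow
  | true, false, true, false => jelbow
  | _, _, _, _ => blank

end Tile

/-! ### Intervals of rows or columns -/

theorem Fin.interval_induction {n : ℕ} {P : Fin n → Prop} {a b : Fin n} (hab : a ≤ b) (ha : P a)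
    (step : ∀ x y : Fin n, (y : ℕ) = x + 1 → a ≤ x → y ≤ b → P x → P y) : P b := by
  have key : ∀ k : ℕ, ∀ y : Fin n, (y : ℕ) = a + k → y ≤ b → P y := by
    intro k
    induction k with
    | zero => intro y hy _; rwa [show y = a from Fin.ext (by simpa using hy)]
    | succ k ih =>
      intro y hy hyb
      have hlt := y.isLt
      refine step ⟨a + k, by omega⟩ y (by simp; omega) (by simp [Fin.le_def]) hyb
        (ih _ rfl ?_)
      simp only [Fin.le_def] at hyb ⊢
      omega
  exact key (b - a) b (by simp only [Fin.le_def] at hab; omega) le_rfl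

theorem Fin.interval_induction_down {n : ℕ} {P : Fin n → Prop} {a b : Fin n} (hab : a ≤ b)
    (hb : P b) (step : ∀ x y : Fin n, (y : ℕ) = x + 1 → a ≤ x → y ≤ b → P y → P x) : P a := by
  by_contra ha
  exact Fin.interval_induction (P := fun x => ¬ P x) hab ha
    (fun x y hxy h1 h2 hx hy => hx (step x y hxy h1 h2 hy)) hb

/-- The last index before `b` at which `P` fails, if `P` fails somewhere before `b`. -/
theorem Fin.exists_last_not {n : ℕ} {P : Fin n → Prop} {a b : Fin n} (hab : a < b) (ha : ¬ P a) :
    ∃ c < b, ¬ P c ∧ ∀ x, c < x → x < b → P x := by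
  classical
  obtain ⟨c, hc, hmax⟩ := (Finset.univ.filter fun x => x < b ∧ ¬ P x).exists_max_image id
    ⟨a, by simp [hab, ha]⟩
  simp only [Finset.mem_filter, Finset.mem_univ, true_and, id] at hc hmax
  refine ⟨c, hc.1, hc.2, fun x hx hxb => ?_⟩
  by_contra hP
  exact absurd (hmax x ⟨hxb, hP⟩) (not_le.mpr hx)

/-- The first index after `a` at which `P` holds, if `P` holds somewhere after `a`. -/
theorem Fin.exists_first {n : ℕ} {P : Fin n → Prop} {a b : Fin n} (hab : a < b) (hb : P b) :
    ∃ c, a < c ∧ P c ∧ ∀ x, a < x → x < c → ¬ P x := by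
  classical
  obtain ⟨c, hc, hmin⟩ := (Finset.univ.filter fun x => a < x ∧ P x).exists_min_image id
    ⟨b, by simp [hab, hb]⟩
  simp only [Finset.mem_filter, Finset.mem_univ, true_and, id] at hc hmin
  exact ⟨c, hc.1, hc.2, fun x hx hxc hP => absurd (hmin x ⟨hx, hP⟩) (not_le.mpr hxc)⟩

/-! ### Following a pipe -/

namespace BPD

variable {n : ℕ}

/-- One step along a pipe: a state `(i, j, h)` consists of a tile and of the heading with which the
pipe enters it. -/
inductive Step (D : BPD n) : Fin n × Fin n × Heading → Fin n × Fin n × Heading → Prop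
  | up {i i' j : Fin n} {h : Heading} (he : (D.tile i j).exit h = some .up)
      (hi : (i' : ℕ) + 1 = i) : Step D (i, j, h) (i', j, .up)
  | right {i j j' : Fin n} {h : Heading} (he : (D.tile i j).exit h = some .right)
      (hj : (j' : ℕ) = j + 1) : Step D (i, j, h) (i, j', .right)

/-- A pipe entering tile `(i, j)` with heading `h` later enters `(i', j')` with heading `h'`. -/
def Reach (D : BPD n) (i j : Fin n) (h : Heading) (i' j' : Fin n) (h' : Heading) : Prop :=
  ReflTransGen D.Step (i, j, h) (i', j', h')

variable {D : BPD n} {p q : Fin n} {i j i' j' : Fin n} {h h' : Heading}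

theorem Reach.invariant (I : Fin n → Fin n → Heading → Prop) (hr : D.Reach i j h i' j' h')
    (h0 : I i j h)
    (hup : ∀ (i i' j : Fin n) (h : Heading), I i j h → (D.tile i j).exit h = some .up →
      (i' : ℕ) + 1 = i → I i' j .up)
    (hright : ∀ (i j j' : Fin n) (h : Heading), I i j h → (D.tile i j).exit h = some .right →
      (j' : ℕ) = j + 1 → I i j' .right) : I i' j' h' := by
  have key : ∀ σ, ReflTransGen D.Step (i, j, h) σ → I σ.1 σ.2.1 σ.2.2 := by
    intro σ hσ
    induction hσ with
    | refl => exact h0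
    | tail _ hs ih =>
      cases hs with
      | up he hi => exact hup _ _ _ _ ih he hi
      | right he hj => exact hright _ _ _ _ ih he hj
  exact key _ hr

theorem Step.rightUnique (D : BPD n) : Relator.RightUnique D.Step := by
  intro σ τ τ' h h'
  cases h with
  | @up i a j h he hi =>
    cases h' with
    | @up _ b _ _ he' hi' => rw [show a = b from Fin.ext (by omega)]
    | right he' hj' => simp [he] at he'
  | @right i j a h he hj =>
    cases h' with
    | up he' hi' => simp [he] at he'
    | @right _ _ b _ he' hj' => rw [show a = b from Fin.ext (by omega)]

theorem Visits.trans (hv : D.Visits p i j h) (hr : D.Reach i j h i' j' h') :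
    D.Visits p i' j' h' :=
  hr.invariant (D.Visits p) hv (fun i i' j h hv => Visits.up i i' j h hv)
    (fun i j j' h hv => Visits.right i j j' h hv)

theorem Visits.reach_start (hv : D.Visits p i j h) :
    ∀ i₀ : Fin n, (i₀ : ℕ) + 1 = n → D.Reach i₀ p .up i j h := by
  intro i₀ h₀
  induction hv with
  | start i hi => rw [show i₀ = i from Fin.ext (by omega)]; exact .refl
  | up i i' j h _ he hi ih => exact ih.tail (.up he hi)
  | right i j j' h _ he hj ih => exact ih.tail (.right he hj)

/-- Of two states of one pipe, one is reached from the other. -/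
theorem Visits.total (hv : D.Visits p i j h) (hv' : D.Visits p i' j' h') :
    D.Reach i j h i' j' h' ∨ D.Reach i' j' h' i j h := by
  have hn : 0 < n := p.pos
  exact ReflTransGen.total_of_right_unique (Step.rightUnique D)
    (hv.reach_start ⟨n - 1, by omega⟩ (by simp; omega))
    (hv'.reach_start ⟨n - 1, by omega⟩ (by simp; omega))

/-- Pipes travel upwards and to the right, and every step changes the tile. -/
theorem Reach.monotone (hr : D.Reach i j h i' j' h') :
    i' ≤ i ∧ j ≤ j' ∧ (i' = i → j' = j → h' = h) := by
  have := hr.invariant (fun a b k => a ≤ i ∧ j ≤ b ∧ (a = i → b = j → k = h))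
    ⟨le_rfl, le_rfl, fun _ _ => rfl⟩
    (fun a a' b k hI _ ha => by
      simp only [Fin.le_def, Fin.ext_iff] at hI ⊢
      exact ⟨by omega, by omega, by omega⟩)
    (fun a b b' k hI _ hb => by
      simp only [Fin.le_def, Fin.ext_iff] at hI ⊢
      exact ⟨by omega, by omega, by omega⟩)
  exact this

theorem Visits.heading_unique (hv : D.Visits p i j h) (hv' : D.Visits p i j h') : h = h' := by
  rcases hv.total hv' with hr | hr
  · exact (hr.monotone.2.2 rfl rfl).symm
  · exact hr.monotone.2.2 rfl rfl

/-- Every pipe segment belongs to a pipe that starts at the south side of the square. -/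
theorem exists_visits (D : BPD n) (i j : Fin n) :
    ((D.tile i j).south = true → ∃ p, D.Visits p i j .up) ∧
    ((D.tile i j).west = true → ∃ p, D.Visits p i j .right) := by
  have key : ∀ k : ℕ, ∀ i j : Fin n, n - i + j = k →
      ((D.tile i j).south = true → ∃ p, D.Visits p i j .up) ∧
      ((D.tile i j).west = true → ∃ p, D.Visits p i j .right) := by
    intro k
    induction k using Nat.strong_induction_on with
    | _ k ih =>
      intro i j hk
      have hi := i.isLt
      refine ⟨fun hs => ?_, fun hw => ?_⟩
      · by_cases hlast : (i : ℕ) + 1 = n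
        · exact ⟨j, .start i hlast⟩
        · let i' : Fin n := ⟨i + 1, by omega⟩
          have hnorth : (D.tile i' j).north = true := by
            rw [← D.match_vertical i i' j rfl, hs]
          have := ih _ (by simp [i']; omega) i' j rfl
          cases hs' : (D.tile i' j).south
          · have hJ := Tile.eq_jelbow_iff'.mp (Tile.eq_jelbow_iff.mpr ⟨hnorth, hs'⟩)
            obtain ⟨p, hp⟩ := this.2 hJ.1
            exact ⟨p, .up i' i j _ hp (Tile.exit_right_eq_up.mpr hJ) rfl⟩
          · obtain ⟨p, hp⟩ := this.1 hs'
            exact ⟨p, .up i' i j _ hp (Tile.exit_up_eq_up.mpr ⟨hs', hnorth⟩) rfl⟩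
      · have hj : (j : ℕ) ≠ 0 := fun h0 => by simp [D.boundary_west i j h0] at hw
        let j' : Fin n := ⟨j - 1, by omega⟩
        have hjj : (j : ℕ) = j' + 1 := by simp [j']; omega
        have heast : (D.tile i j').east = true := by
          rw [D.match_horizontal i j' j hjj, hw]
        have := ih _ (by simp [j']; omega) i j' rfl
        cases hw' : (D.tile i j').west
        · have hR := Tile.eq_relbow_iff.mp (Tile.eq_relbow_iff'.mpr ⟨heast, hw'⟩)
          obtain ⟨p, hp⟩ := this.1 hR.1
          exact ⟨p, .right i j' j _ hp (Tile.exit_up_eq_right.mpr hR) hjj⟩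
        · obtain ⟨p, hp⟩ := this.2 hw'
          exact ⟨p, .right i j' j _ hp (Tile.exit_right_eq_right.mpr ⟨hw', heast⟩) hjj⟩
  exact key _ i j rfl

theorem Visits.right_run {j₁ j₂ : Fin n} (hv : D.Visits p i j₁ .right) (hj : j₁ ≤ j₂)
    (hrow : ∀ j, j₁ ≤ j → j < j₂ → (D.tile i j).west = true ∧ (D.tile i j).east = true) :
    D.Visits p i j₂ .right := by
  refine Fin.interval_induction (P := fun j => D.Visits p i j .right) hj hv ?_
  intro x y hxy hx hy hP
  refine .right i x y _ hP (Tile.exit_right_eq_right.mpr (hrow x hx ?_)) hxy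
  simp only [Fin.lt_def, Fin.le_def] at *; omega

theorem Visits.up_run {i₁ i₂ : Fin n} (hv : D.Visits p i₂ j .up) (hi : i₁ ≤ i₂)
    (hcol : ∀ i, i₁ < i → i ≤ i₂ → (D.tile i j).south = true ∧ (D.tile i j).north = true) :
    D.Visits p i₁ j .up := by
  refine Fin.interval_induction_down (P := fun i => D.Visits p i j .up) hi hv ?_
  intro x y hxy hx hy hP
  refine .up y x j _ hP (Tile.exit_up_eq_up.mpr (hcol y ?_ hy)) hxy.symm
  simp only [Fin.lt_def, Fin.le_def] at *; omega

/-- A vertical run of a pipe can be followed backwards. -/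
theorem Visits.up_run_symm {i₁ i₂ : Fin n} (hv : D.Visits p i₁ j .up) (hi : i₁ ≤ i₂)
    (hcol : ∀ i, i₁ < i → i ≤ i₂ → (D.tile i j).south = true ∧ (D.tile i j).north = true) :
    D.Visits p i₂ j .up := by
  refine Fin.interval_induction (P := fun i => D.Visits p i j .up) hi hv ?_
  intro x y hxy hx hy hP
  have hy' := y.isLt
  have hside := hcol y (by simp only [Fin.lt_def, Fin.le_def] at *; omega) hy
  cases hP with
  | start _ hlast => omega
  | up i _ _ h hv he hi =>
    obtain rfl : i = y := Fin.ext (by omega)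
    cases h with
    | up => exact hv
    | right =>
      have := Tile.eq_jelbow_iff.mp (Tile.eq_jelbow_iff'.mpr (Tile.exit_right_eq_up.mp he))
      simp [hside.1] at this

theorem CrossAt.symm {c : Fin n × Fin n} (hc : D.CrossAt p q c) : D.CrossAt q p c :=
  ⟨hc.1, hc.2.symm⟩

end BPD

namespace Tile

theorem flow (t : Tile) : (t.north = t.south ∧ t.west = t.east) ∨
    (t.south = t.east ∧ t.north = t.west) := by
  cases t <;> simp [north, south, west, east]

/-- The six tiles realize every choice of sides that pairs the entering with the leaving sides. -/
theorem sides_ofSides {n s w e : Bool} (h : (n = s ∧ w = e) ∨ (s = e ∧ n = w)) :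
    (ofSides n s w e).north = n ∧ (ofSides n s w e).south = s ∧
    (ofSides n s w e).west = w ∧ (ofSides n s w e).east = e := by
  revert h
  cases n <;> cases s <;> cases w <;> cases e <;> simp [ofSides, north, south, west, east]

end Tile

/-! ### Moving a pipe segment across a rectangle -/

namespace BPD

variable {n : ℕ}

/-- The rectangle with rows `i₁, …, i₂` and columns `j₁, …, j₂` can be toggled upwards: pipes run
between the centres of neighbouring tiles everywhere along its south and east borders, and nowhere
along its north and west borders. -/
structure Movable (D : BPD n) (i₁ i₂ j₁ j₂ : Fin n) : Prop where
  rows_lt : i₁ < i₂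
  cols_lt : j₁ < j₂
  top : ∀ j, j₁ ≤ j → j < j₂ → (D.tile i₁ j).east = false
  bottom : ∀ j, j₁ ≤ j → j < j₂ → (D.tile i₂ j).east = true
  left : ∀ i, i₁ ≤ i → i < i₂ → (D.tile i j₁).south = false
  right : ∀ i, i₁ ≤ i → i < i₂ → (D.tile i j₂).south = true

variable {D : BPD n} {i₁ i₂ j₁ j₂ : Fin n}

theorem west_eq_of_lt (D : BPD n) (i : Fin n) {j j' : Fin n} (h : j < j') :
    ∃ k, j ≤ k ∧ k < j' ∧ (k : ℕ) + 1 = j' ∧ (D.tile i j').west = (D.tile i k).east := by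
  have := j'.isLt
  simp only [Fin.lt_def, Fin.le_def] at *
  refine ⟨⟨j' - 1, by omega⟩, by simp; omega, by simp; omega, by simp; omega, ?_⟩
  exact (D.match_horizontal _ _ _ (by simp; omega)).symm

theorem north_eq_of_lt (D : BPD n) (j : Fin n) {i i' : Fin n} (h : i < i') :
    ∃ k, i ≤ k ∧ k < i' ∧ (k : ℕ) + 1 = i' ∧ (D.tile i' j).north = (D.tile k j).south := by
  have := i'.isLt
  simp only [Fin.lt_def, Fin.le_def] at *
  refine ⟨⟨i' - 1, by omega⟩, by simp; omega, by simp; omega, by simp; omega, ?_⟩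
  exact (D.match_vertical _ _ _ (by simp; omega)).symm

namespace Movable

theorem top_west (hM : D.Movable i₁ i₂ j₁ j₂) (j : Fin n) (h1 : j₁ < j) (h2 : j ≤ j₂) :
    (D.tile i₁ j).west = false := by
  obtain ⟨k, hk1, hk2, -, hk⟩ := D.west_eq_of_lt i₁ h1
  rw [hk, hM.top k hk1 (hk2.trans_le h2)]

theorem bottom_west (hM : D.Movable i₁ i₂ j₁ j₂) (j : Fin n) (h1 : j₁ < j) (h2 : j ≤ j₂) :
    (D.tile i₂ j).west = true := by
  obtain ⟨k, hk1, hk2, -, hk⟩ := D.west_eq_of_lt i₂ h1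
  rw [hk, hM.bottom k hk1 (hk2.trans_le h2)]

theorem left_north (hM : D.Movable i₁ i₂ j₁ j₂) (i : Fin n) (h1 : i₁ < i) (h2 : i ≤ i₂) :
    (D.tile i j₁).north = false := by
  obtain ⟨k, hk1, hk2, -, hk⟩ := D.north_eq_of_lt j₁ h1
  rw [hk, hM.left k hk1 (hk2.trans_le h2)]

theorem right_north (hM : D.Movable i₁ i₂ j₁ j₂) (i : Fin n) (h1 : i₁ < i) (h2 : i ≤ i₂) :
    (D.tile i j₂).north = true := by
  obtain ⟨k, hk1, hk2, -, hk⟩ := D.north_eq_of_lt j₂ h1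
  rw [hk, hM.right k hk1 (hk2.trans_le h2)]

end Movable

/-- The value of the side `old` of a tile after toggling, if the side lies on the border of the
rectangle: sides on the first border line (`a = a₁`) are switched on, those on the second one
(`a = a₂`) are switched off. Here `between` says that the side lies within the extent of the
rectangle along that line. -/
def toggleSide (a a₁ a₂ : Fin n) (between : Bool) (old : Bool) : Bool :=
  if between then (if a = a₁ then true else if a = a₂ then false else old) else old

/-- The tiles after toggling a rectangle: pipe segments move from the south border to the north
border and from the east border to the west border. -/
def movedTile (D : BPD n) (i₁ i₂ j₁ j₂ i j : Fin n) : Tile :=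
  Tile.ofSides
    (toggleSide j j₁ j₂ (i₁ < i ∧ i ≤ i₂) (D.tile i j).north)
    (toggleSide j j₁ j₂ (i₁ ≤ i ∧ i < i₂) (D.tile i j).south)
    (toggleSide i i₁ i₂ (j₁ < j ∧ j ≤ j₂) (D.tile i j).west)
    (toggleSide i i₁ i₂ (j₁ ≤ j ∧ j < j₂) (D.tile i j).east)

theorem Movable.movedTile_sides (hM : D.Movable i₁ i₂ j₁ j₂) (i j : Fin n) :
    (D.movedTile i₁ i₂ j₁ j₂ i j).north =
      toggleSide j j₁ j₂ (i₁ < i ∧ i ≤ i₂) (D.tile i j).north ∧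
    (D.movedTile i₁ i₂ j₁ j₂ i j).south =
      toggleSide j j₁ j₂ (i₁ ≤ i ∧ i < i₂) (D.tile i j).south ∧
    (D.movedTile i₁ i₂ j₁ j₂ i j).west =
      toggleSide i i₁ i₂ (j₁ < j ∧ j ≤ j₂) (D.tile i j).west ∧
    (D.movedTile i₁ i₂ j₁ j₂ i j).east =
      toggleSide i i₁ i₂ (j₁ ≤ j ∧ j < j₂) (D.tile i j).east := by
  obtain ⟨hi, hj, ht, hb, hl, hr⟩ := id hM
  have ht' := hM.top_west
  have hb' := hM.bottom_west
  have hl' := hM.left_north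
  have hr' := hM.right_north
  refine Tile.sides_ofSides ?_
  have hflow := (D.tile i j).flow
  unfold toggleSide
  grind

/-- The bumpless pipe dream that results from toggling a rectangle upwards. -/
def Movable.move (hM : D.Movable i₁ i₂ j₁ j₂) : BPD n where
  tile := D.movedTile i₁ i₂ j₁ j₂
  match_horizontal i j j' hj := by
    rw [(hM.movedTile_sides i j).2.2.2, (hM.movedTile_sides i j').2.2.1,
      D.match_horizontal i j j' hj]
    congr 2
    simp only [Fin.lt_def, Fin.le_def, eq_iff_iff]
    omega
  match_vertical i i' j hi := by
    rw [(hM.movedTile_sides i j).2.1, (hM.movedTile_sides i' j).1,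
      D.match_vertical i i' j hi]
    congr 2
    simp only [Fin.lt_def, Fin.le_def, eq_iff_iff]
    omega
  boundary_west i j hj := by
    rw [(hM.movedTile_sides i j).2.2.1, D.boundary_west i j hj, toggleSide,
      if_neg (by simp only [decide_eq_true_eq, Fin.lt_def]; omega)]
  boundary_east i j hj := by
    rw [(hM.movedTile_sides i j).2.2.2, D.boundary_east i j hj, toggleSide,
      if_neg (by simp only [decide_eq_true_eq, Fin.lt_def]; omega)]
  boundary_north i j hi := by
    rw [(hM.movedTile_sides i j).1, D.boundary_north i j hi, toggleSide,
      if_neg (by simp only [decide_eq_true_eq, Fin.lt_def]; omega)]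
  boundary_south i j hi := by
    rw [(hM.movedTile_sides i j).2.1, D.boundary_south i j hi, toggleSide,
      if_neg (by simp only [decide_eq_true_eq, Fin.lt_def]; omega)]

namespace Movable

theorem move_north (hM : D.Movable i₁ i₂ j₁ j₂) (i j : Fin n) : (hM.move.tile i j).north =
    if i₁ < i ∧ i ≤ i₂ then (if j = j₁ then true else if j = j₂ then false
      else (D.tile i j).north) else (D.tile i j).north := by
  simpa [toggleSide, move] using (hM.movedTile_sides i j).1

theorem move_south (hM : D.Movable i₁ i₂ j₁ j₂) (i j : Fin n) : (hM.move.tile i j).south =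
    if i₁ ≤ i ∧ i < i₂ then (if j = j₁ then true else if j = j₂ then false
      else (D.tile i j).south) else (D.tile i j).south := by
  simpa [toggleSide, move] using (hM.movedTile_sides i j).2.1

theorem move_west (hM : D.Movable i₁ i₂ j₁ j₂) (i j : Fin n) : (hM.move.tile i j).west =
    if j₁ < j ∧ j ≤ j₂ then (if i = i₁ then true else if i = i₂ then false
      else (D.tile i j).west) else (D.tile i j).west := by
  simpa [toggleSide, move] using (hM.movedTile_sides i j).2.2.1

theorem move_east (hM : D.Movable i₁ i₂ j₁ j₂) (i j : Fin n) : (hM.move.tile i j).east =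
    if j₁ ≤ j ∧ j < j₂ then (if i = i₁ then true else if i = i₂ then false
      else (D.tile i j).east) else (D.tile i j).east := by
  simpa [toggleSide, move] using (hM.movedTile_sides i j).2.2.2

/-- Tiles off the border of the rectangle do not change. -/
theorem move_tile_eq (hM : D.Movable i₁ i₂ j₁ j₂) {i j : Fin n}
    (h : ¬ (i₁ ≤ i ∧ i ≤ i₂ ∧ j₁ ≤ j ∧ j ≤ j₂) ∨ (i₁ < i ∧ i < i₂ ∧ j₁ < j ∧ j < j₂)) :
    hM.move.tile i j = D.tile i j := by
  have hi := hM.rows_lt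
  have hj := hM.cols_lt
  apply Tile.ext_sides
  · rw [hM.move_north]; grind
  · rw [hM.move_south]; grind
  · rw [hM.move_west]; grind
  · rw [hM.move_east]; grind

end Movable

/-- The sum of the row indices of all tiles that a pipe leaves through the east side. Upward
toggles shift horizontal pipe segments to smaller rows, and so decrease it. -/
def depth (D : BPD n) : ℕ := ∑ j : Fin n, ∑ i : Fin n, if (D.tile i j).east then (i : ℕ) else 0

theorem Movable.depth_move_lt (hM : D.Movable i₁ i₂ j₁ j₂) : hM.move.depth < D.depth := by
  have hi := hM.rows_lt
  have hj := hM.cols_lt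
  -- Exchanging the rows `i₁` and `i₂` of the sum for the new dream makes the comparison termwise.
  have hcol : ∀ j, j₁ ≤ j → j < j₂ →
      (∑ i : Fin n, if (hM.move.tile i j).east then (i : ℕ) else 0) <
        ∑ i : Fin n, if (D.tile i j).east then (i : ℕ) else 0 := by
    intro j h1 h2
    rw [← Equiv.sum_comp (Equiv.swap i₁ i₂)]
    have hb := hM.bottom j h1 h2
    refine Finset.sum_lt_sum (fun i _ => ?_) ⟨i₂, Finset.mem_univ _, ?_⟩
    · rcases eq_or_ne i i₁ with rfl | hi1
      · simp [hM.move_east, h1, h2, hi.ne']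
      · rcases eq_or_ne i i₂ with rfl | hi2
        · simp [hM.move_east, h1, h2, hb, hi.le]
        · simp [Equiv.swap_apply_of_ne_of_ne hi1 hi2, hM.move_east, hi1, hi2]
    · simpa [hM.move_east, h1, h2, hb] using hi
  refine Finset.sum_lt_sum (fun j _ => ?_) ⟨j₁, Finset.mem_univ _, hcol j₁ le_rfl hj⟩
  by_cases h : j₁ ≤ j ∧ j < j₂
  · exact (hcol j h.1 h.2).le
  · simp [hM.move_east, h]

/-- Toggling a rectangle of two rows and two columns is a `2 × 2` flip. -/
theorem Movable.upFlip_move (hM : D.Movable i₁ i₂ j₁ j₂) (hi : (i₂ : ℕ) = i₁ + 1)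
    (hj : (j₂ : ℕ) = j₁ + 1) : D.UpFlip hM.move := by
  have hi' := hM.rows_lt
  have hj' := hM.cols_lt
  refine ⟨i₁, i₂, j₁, j₂, hi, hj, ?_, ?_, ?_, ?_, fun k l hkl => hM.move_tile_eq ?_⟩
  · have h1 := hM.top j₁ le_rfl hj'
    have h2 := hM.left i₁ le_rfl hi'
    have h3 := hM.move_north i₁ j₁
    have h4 := hM.move_west i₁ j₁
    have h5 := hM.move_south i₁ j₁
    have h6 := hM.move_east i₁ j₁
    cases h : D.tile i₁ j₁ <;> cases h' : hM.move.tile i₁ j₁ <;>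
      simp_all [Tile.north, Tile.south, Tile.west, Tile.east]
  · have h1 := hM.top_west j₂ hj' le_rfl
    have h2 := hM.right i₁ le_rfl hi'
    have h3 := hM.move_north i₁ j₂
    have h4 := hM.move_west i₁ j₂
    have h5 := hM.move_south i₁ j₂
    have h6 := hM.move_east i₁ j₂
    cases h : D.tile i₁ j₂ <;> cases h' : hM.move.tile i₁ j₂ <;>
      simp_all [Tile.north, Tile.south, Tile.west, Tile.east, hj'.ne']
  · have h1 := hM.bottom j₁ le_rfl hj'
    have h2 := hM.left_north i₂ hi' le_rfl
    have h3 := hM.move_north i₂ j₁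
    have h4 := hM.move_west i₂ j₁
    have h5 := hM.move_south i₂ j₁
    have h6 := hM.move_east i₂ j₁
    cases h : D.tile i₂ j₁ <;> cases h' : hM.move.tile i₂ j₁ <;>
      simp_all [Tile.north, Tile.south, Tile.west, Tile.east, hi'.ne']
  · have h1 := hM.bottom_west j₂ hj' le_rfl
    have h2 := hM.right_north i₂ hi' le_rfl
    have h3 := hM.move_north i₂ j₂
    have h4 := hM.move_west i₂ j₂
    have h5 := hM.move_south i₂ j₂
    have h6 := hM.move_east i₂ j₂
    cases h : D.tile i₂ j₂ <;> cases h' : hM.move.tile i₂ j₂ <;>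
      simp_all [Tile.north, Tile.south, Tile.west, Tile.east, hi'.ne', hj'.ne']
  · left
    simp only [Fin.le_def, Fin.ext_iff] at hkl ⊢
    omega

/-- Toggling a rectangle is an undroop if its only elbows are r-elbows in the NE and SW corners and
a j-elbow in the SE corner. -/
theorem Movable.droop_move (hM : D.Movable i₁ i₂ j₁ j₂) (hnw : D.tile i₁ j₁ = .blank)
    (hne : D.tile i₁ j₂ = .relbow) (hsw : D.tile i₂ j₁ = .relbow) (hse : D.tile i₂ j₂ = .jelbow)
    (hint : ∀ i j, i₁ < i → i < i₂ → j₁ < j → j < j₂ → ¬ (D.tile i j).IsElbow) :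
    hM.move.Droop D := by
  have hi := hM.rows_lt
  have hj := hM.cols_lt
  have ht' := hM.top_west
  have hb' := hM.bottom_west
  have hl' := hM.left_north
  have hr' := hM.right_north
  obtain ⟨-, -, ht, hb, hl, hr⟩ := id hM
  refine ⟨i₁, i₂, j₁, j₂, hi, hj, ?_, ?_, ?_, hnw, hse, hne, hsw, ?_, ?_, ?_, ?_, ?_, ?_⟩
  · have hnorth : (D.tile i₁ j₁).north = false := by rw [hnw]; rfl
    simp [Tile.eq_relbow_iff, hM.move_south, hM.move_north, hi, hnorth]
  · have hsouth : (D.tile i₂ j₂).south = false := by rw [hse]; rfl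
    have heast : (D.tile i₂ j₂).east = false := by rw [hse]; rfl
    simp [Tile.eq_blank_iff, hM.move_south, hM.move_north, hM.move_east, hM.move_west, hi, hj,
      hsouth, heast, hi.ne', hj.ne']
  · intro i j h1 h2 h3 h4 hc
    rw [Tile.not_isElbow_iff, hM.move_south, hM.move_north, hM.move_east, hM.move_west]
    have hint' : i₁ < i → i < i₂ → j₁ < j → j < j₂ → (D.tile i j).north = (D.tile i j).south ∧
        (D.tile i j).west = (D.tile i j).east := fun a b c d =>
      Tile.not_isElbow_iff.mp (hint i j a b c d)
    have hflow := (D.tile i j).flow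
    grind
  · intro j h1 h2
    apply Tile.addHoriz_of_sides
    · grind [hM.move_north i₁ j]
    · grind [hM.move_south i₁ j]
    · grind
    · grind
    · grind [hM.move_west i₁ j]
    · grind [hM.move_east i₁ j]
  · intro i h1 h2
    apply Tile.addVert_of_sides
    · grind [hM.move_west i j₁]
    · grind [hM.move_east i j₁]
    · grind
    · grind
    · grind [hM.move_north i j₁]
    · grind [hM.move_south i j₁]
  · intro j h1 h2
    apply Tile.addHoriz_of_sides
    · grind [hM.move_north i₂ j]
    · grind [hM.move_south i₂ j]
    · grind [hM.move_west i₂ j]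
    · grind [hM.move_east i₂ j]
    · grind
    · grind
  · intro i h1 h2
    apply Tile.addVert_of_sides
    · grind [hM.move_west i j₂]
    · grind [hM.move_east i j₂]
    · grind [hM.move_north i j₂]
    · grind [hM.move_south i j₂]
    · grind
    · grind
  · exact fun i j h1 h2 h3 h4 => (hM.move_tile_eq (.inr ⟨h1, h2, h3, h4⟩)).symm
  · exact fun i j h => (hM.move_tile_eq (.inl h)).symm

/-! ### Undroops keep a bumpless pipe dream reduced -/

/-- The states of the new path through the rectangle that the undrooped pipe takes:
up the first column and then right along the first row. -/
def OnNewPath (i₁ i₂ j₁ j₂ i j : Fin n) (h : Heading) : Prop :=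
  (h = .up ∧ j = j₁ ∧ i₁ ≤ i ∧ i ≤ i₂) ∨ (h = .right ∧ i = i₁ ∧ j₁ < j ∧ j ≤ j₂)

namespace Movable

/-- The pipe that enters the SW corner from below runs along the south border. -/
theorem visits_bottom (hM : D.Movable i₁ i₂ j₁ j₂) (hsw : D.tile i₂ j₁ = .relbow) {p j : Fin n}
    (hv : D.Visits p i₂ j₁ .up) (h1 : j₁ < j) (h2 : j ≤ j₂) : D.Visits p i₂ j .right := by
  obtain ⟨k, hk⟩ : ∃ k : Fin n, (k : ℕ) = j₁ + 1 := by
    simp only [Fin.lt_def] at h1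
    exact ⟨⟨j₁ + 1, by omega⟩, rfl⟩
  have hstart : D.Visits p i₂ k .right := .right i₂ j₁ k _ hv (by rw [hsw]; rfl) hk
  refine hstart.right_run (by simp only [Fin.lt_def, Fin.le_def] at *; omega) fun x hx1 hx2 => ?_
  have hx : j₁ < x := by simp only [Fin.lt_def, Fin.le_def] at *; omega
  exact ⟨hM.bottom_west x hx (hx2.le.trans h2), hM.bottom x hx.le (hx2.trans_le h2)⟩

/-- The pipe that enters the SW corner from below turns at the SE corner and runs along the east
border. -/
theorem visits_right (hM : D.Movable i₁ i₂ j₁ j₂) (hsw : D.tile i₂ j₁ = .relbow)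
    (hse : D.tile i₂ j₂ = .jelbow) {p i : Fin n}
    (hv : D.Visits p i₂ j₁ .up) (h1 : i₁ ≤ i) (h2 : i < i₂) : D.Visits p i j₂ .up := by
  obtain ⟨k, hk⟩ : ∃ k : Fin n, (k : ℕ) + 1 = i₂ := by
    simp only [Fin.lt_def] at h2
    exact ⟨⟨i₂ - 1, by omega⟩, by simp; omega⟩
  have hstart : D.Visits p k j₂ .up :=
    .up i₂ k j₂ _ (hM.visits_bottom hsw hv hM.cols_lt le_rfl) (by rw [hse]; rfl) hk
  refine hstart.up_run (by simp only [Fin.lt_def, Fin.le_def] at *; omega) fun x hx1 hx2 => ?_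
  have hx : x < i₂ := by simp only [Fin.lt_def, Fin.le_def] at *; omega
  exact ⟨hM.right x (h1.trans hx1.le) hx, hM.right_north x (h1.trans_lt hx1) hx.le⟩

/-- Outside the new path the pipes visit the same states before and after the undroop, and the new
path belongs to the pipe that entered the rectangle at its SW corner. -/
theorem visits_of_visits_move (hM : D.Movable i₁ i₂ j₁ j₂) (hnw : D.tile i₁ j₁ = .blank)
    (hne : D.tile i₁ j₂ = .relbow) (hsw : D.tile i₂ j₁ = .relbow) (hse : D.tile i₂ j₂ = .jelbow)
    {p i j : Fin n} {h : Heading} (hv : hM.move.Visits p i j h) :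
    (OnNewPath i₁ i₂ j₁ j₂ i j h ∧ D.Visits p i₂ j₁ .up) ∨
      (¬ OnNewPath i₁ i₂ j₁ j₂ i j h ∧ D.Visits p i j h) := by
  have hi := hM.rows_lt
  have hj := hM.cols_lt
  have hnw' := Tile.eq_blank_iff.mp hnw
  have hne' := Tile.eq_relbow_iff.mp hne
  have hne'' := Tile.eq_relbow_iff'.mp hne
  have hsw' := Tile.eq_relbow_iff.mp hsw
  have hsw'' := Tile.eq_relbow_iff'.mp hsw
  have hse' := Tile.eq_jelbow_iff.mp hse
  have hse'' := Tile.eq_jelbow_iff'.mp hse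
  have ht' := hM.top_west
  have hb' := hM.bottom_west
  have hl' := hM.left_north
  have hr' := hM.right_north
  obtain ⟨-, -, ht, hb, hl, hr⟩ := id hM
  induction hv with
  | start i hlast =>
    have : ∀ hp : OnNewPath i₁ i₂ j₁ j₂ i p .up, i = i₂ ∧ p = j₁ := by
      intro hp
      simp only [OnNewPath, Fin.le_def, Fin.ext_iff] at hp ⊢
      grind
    by_cases hp : OnNewPath i₁ i₂ j₁ j₂ i p .up
    · obtain ⟨rfl, rfl⟩ := this hp
      exact .inl ⟨hp, .start i hlast⟩
    · exact .inr ⟨hp, .start i hlast⟩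
  | up i i' j h _ he hi' ih =>
    have hD : (D.tile i j).exit h = some .up → D.Visits p i j h → D.Visits p i' j .up :=
      fun he hv => .up i i' j h hv he hi'
    have hflow := (D.tile i j).flow
    have h1 := hM.move_north i j
    have h2 := hM.move_south i j
    have h3 := hM.move_west i j
    have h4 := hM.move_east i j
    simp only [OnNewPath, Fin.lt_def, Fin.le_def, Fin.ext_iff] at *
    cases h
    · rw [Tile.exit_up_eq_up] at he hD
      grind
    · rw [Tile.exit_right_eq_up] at he hD
      grind
  | right i j j' h _ he hj' ih =>
    have hD : (D.tile i j).exit h = some .right → D.Visits p i j h → D.Visits p i j' .right :=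
      fun he hv => .right i j j' h hv he hj'
    have hout : D.Visits p i₂ j₁ .up → j = j₂ → D.Visits p i₁ j' .right := by
      rintro hv rfl
      exact .right i₁ j j' _ (hM.visits_right hsw hse hv le_rfl hi) (by rw [hne]; rfl) hj'
    have hflow := (D.tile i j).flow
    have h1 := hM.move_north i j
    have h2 := hM.move_south i j
    have h3 := hM.move_west i j
    have h4 := hM.move_east i j
    have hi₁ : i = i₁ ∨ i ≠ i₁ := em _
    cases h
    · rw [Tile.exit_up_eq_right] at he hD
      rcases hi₁ with rfl | hi₁ <;>
      simp only [OnNewPath, Fin.lt_def, Fin.le_def, Fin.ext_iff] at * <;>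
      grind
    · rw [Tile.exit_right_eq_right] at he hD
      rcases hi₁ with rfl | hi₁ <;>
      simp only [OnNewPath, Fin.lt_def, Fin.le_def, Fin.ext_iff] at * <;>
      grind

/-- The pipe of the undroop crosses every pipe that passes through the rectangle once before and
once after it; this is the crossing of `D` that corresponds to a crossing after the undroop. -/
def oldCross (_ : D.Movable i₁ i₂ j₁ j₂) (c : Fin n × Fin n) : Fin n × Fin n :=
  if c.1 = i₁ ∧ j₁ < c.2 ∧ c.2 < j₂ then (i₂, c.2)
  else if c.2 = j₁ ∧ i₁ < c.1 ∧ c.1 < i₂ then (c.1, j₂) else c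

theorem oldCross_injOn (hM : D.Movable i₁ i₂ j₁ j₂) :
    Set.InjOn hM.oldCross {c | hM.move.tile c.1 c.2 = .cross} := by
  rintro ⟨i, j⟩ hc ⟨i', j'⟩ hc' h
  have hi := hM.rows_lt
  have hj := hM.cols_lt
  simp only [Set.mem_ofPred_eq, Tile.eq_cross_iff] at hc hc'
  have h1 := hM.move_west i j
  have h2 := hM.move_south i j
  have h3 := hM.move_west i' j'
  have h4 := hM.move_south i' j'
  simp only [oldCross] at h
  rw [Prod.ext_iff]
  grind

/-- Two pipes that cross after the undroop cross before it at the tile given by `oldCross`. -/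
theorem visits_crossing (hM : D.Movable i₁ i₂ j₁ j₂) (hnw : D.tile i₁ j₁ = .blank)
    (hne : D.tile i₁ j₂ = .relbow) (hsw : D.tile i₂ j₁ = .relbow) (hse : D.tile i₂ j₂ = .jelbow)
    (hint : ∀ i j, i₁ < i → i < i₂ → j₁ < j → j < j₂ → ¬ (D.tile i j).IsElbow)
    {p q i j : Fin n} (hc : hM.move.tile i j = .cross) (hp : hM.move.Visits p i j .up)
    (hq : hM.move.Visits q i j .right) : D.CrossAt p q (hM.oldCross (i, j)) := by
  have hi := hM.rows_lt
  have hj := hM.cols_lt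
  have hne' := Tile.eq_relbow_iff.mp hne
  have hsw'' := Tile.eq_relbow_iff'.mp hsw
  have hnw' := Tile.eq_blank_iff.mp hnw
  have hse' := Tile.eq_jelbow_iff.mp hse
  rw [Tile.eq_cross_iff] at hc
  have h1 := hM.move_north i j
  have h2 := hM.move_south i j
  have h3 := hM.move_west i j
  have h4 := hM.move_east i j
  rcases hM.visits_of_visits_move hnw hne hsw hse hp with ⟨hPp, hDp⟩ | ⟨hPp, hDp⟩
  · -- `p` is the pipe of the undroop, crossed in the first column: it was crossed in the last.
    obtain ⟨rfl, hi1, hi2⟩ : j = j₁ ∧ i₁ ≤ i ∧ i ≤ i₂ := by simpa [OnNewPath] using hPp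
    replace hi1 : i₁ < i := lt_of_le_of_ne hi1 (by rintro rfl; grind)
    replace hi2 : i < i₂ := lt_of_le_of_ne hi2 (by rintro rfl; grind)
    have hq' : D.Visits q i j .right := by
      rcases hM.visits_of_visits_move hnw hne hsw hse hq with ⟨hPq, -⟩ | ⟨-, hq⟩
      · simp [OnNewPath] at hPq
      · exact hq
    have hrow : ∀ x, j ≤ x → x < j₂ → (D.tile i x).west = true ∧ (D.tile i x).east = true := by
      intro x hx hx2
      refine Fin.interval_induction (P := fun x => (D.tile i x).west = true ∧
        (D.tile i x).east = true) hx (by grind) fun y z hyz hy hz hP => ?_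
      have := Tile.not_isElbow_iff.mp (hint i z hi1 hi2
        (by simp only [Fin.lt_def, Fin.le_def] at *; omega) (hz.trans_lt hx2))
      have := D.match_horizontal i y z hyz
      grind
    have hcross : hM.oldCross (i, j) = (i, j₂) := by simp [oldCross, hi1, hi2]
    rw [hcross]
    refine ⟨Tile.eq_cross_iff.mpr ?_, .inl ⟨hM.visits_right hsw hse hDp hi1.le hi2,
      hq'.right_run hj.le hrow⟩⟩
    have h5 := hM.right i hi1.le hi2
    have h6 := hM.right_north i hi1 hi2.le
    obtain ⟨k, hk1, hk2, -, hk⟩ := D.west_eq_of_lt i hj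
    have h7 := (hrow k hk1 hk2).2
    have hflow := (D.tile i j₂).flow
    grind
  rcases hM.visits_of_visits_move hnw hne hsw hse hq with ⟨hPq, hDq⟩ | ⟨hPq, hDq⟩
  · -- `q` is the pipe of the undroop, crossed in the first row: it was crossed in the last.
    obtain ⟨rfl, hj1, hj2⟩ : i = i₁ ∧ j₁ < j ∧ j ≤ j₂ := by simpa [OnNewPath] using hPq
    replace hj2 : j < j₂ := lt_of_le_of_ne hj2 (by rintro rfl; grind)
    have hcol : ∀ x, i ≤ x → x < i₂ → (D.tile x j).south = true ∧ (D.tile x j).north = true := by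
      intro x hx hx2
      refine Fin.interval_induction (P := fun x => (D.tile x j).south = true ∧
        (D.tile x j).north = true) hx (by grind) fun y z hyz hy hz hP => ?_
      have := Tile.not_isElbow_iff.mp (hint z j
        (by simp only [Fin.lt_def, Fin.le_def] at *; omega) (hz.trans_lt hx2) hj1 hj2)
      have := D.match_vertical y z j hyz
      grind
    have hcross : hM.oldCross (i, j) = (i₂, j) := by simp [oldCross, hj1, hj2]
    have hc' : D.tile i₂ j = .cross := by
      have h5 := hM.bottom j hj1.le hj2
      have h6 := hM.bottom_west j hj1 hj2.le
      obtain ⟨k, hk1, hk2, -, hk⟩ := D.north_eq_of_lt j hi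
      have h7 := (hcol k hk1 hk2).1
      have hflow := (D.tile i₂ j).flow
      rw [Tile.eq_cross_iff]
      grind
    rw [hcross]
    refine ⟨hc', .inl ⟨hDp.up_run_symm hi.le fun x hx hx2 => ?_,
      hM.visits_bottom hsw hDq hj1 hj2.le⟩⟩
    rcases hx2.eq_or_lt with rfl | hx2
    · exact ⟨by rw [hc']; rfl, by rw [hc']; rfl⟩
    · exact hcol x hx.le hx2
  · have hcross : hM.oldCross (i, j) = (i, j) := by
      simp only [OnNewPath, oldCross] at *
      grind
    rw [hcross]
    refine ⟨Tile.eq_cross_iff.mpr ?_, .inl ⟨hDp, hDq⟩⟩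
    simp only [OnNewPath] at *
    grind

theorem isReduced_move_of_undroop (hM : D.Movable i₁ i₂ j₁ j₂) (hD : D.IsReduced)
    (hnw : D.tile i₁ j₁ = .blank) (hne : D.tile i₁ j₂ = .relbow) (hsw : D.tile i₂ j₁ = .relbow)
    (hse : D.tile i₂ j₂ = .jelbow)
    (hint : ∀ i j, i₁ < i → i < i₂ → j₁ < j → j < j₂ → ¬ (D.tile i j).IsElbow) :
    hM.move.IsReduced := by
  intro p q hpq c hc c' hc'
  have key : ∀ c, hM.move.CrossAt p q c → D.CrossAt p q (hM.oldCross c) := by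
    rintro ⟨i, j⟩ ⟨hc, ⟨hp, hq⟩ | ⟨hq, hp⟩⟩
    · exact hM.visits_crossing hnw hne hsw hse hint hc hp hq
    · exact (hM.visits_crossing hnw hne hsw hse hint hc hq hp).symm
  exact hM.oldCross_injOn hc.1 hc'.1 (hD p q hpq (key c hc) (key c' hc'))

end Movable

/-! ### Undrooping at a j-elbow -/

/-- A reduced bumpless pipe dream with a j-elbow can be undrooped: take a j-elbow with no other one
to its northwest, and follow its pipe to the nearest r-elbow in both directions. An r-elbow inside
the resulting rectangle would belong to a pipe that crosses this pipe twice. -/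
theorem IsReduced.exists_undroop (hD : D.IsReduced) (hJ : ∃ i j, D.tile i j = .jelbow) :
    ∃ D' : BPD n, D'.IsReduced ∧ D.Undroop D' ∧ D'.depth < D.depth := by
  classical
  obtain ⟨⟨i₂, j₂⟩, hse, hmin⟩ := (Finset.univ.filter fun c : Fin n × Fin n =>
    D.tile c.1 c.2 = .jelbow).exists_min_image (fun c => (c.1 : ℕ) + c.2)
      (by obtain ⟨i, j, h⟩ := hJ; exact ⟨(i, j), by simpa using h⟩)
  simp only [Finset.mem_filter, Finset.mem_univ, true_and, Prod.forall] at hse hmin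
  have hnoJ : ∀ i j, i ≤ i₂ → j ≤ j₂ → ¬ (i = i₂ ∧ j = j₂) →
      ¬ ((D.tile i j).west = true ∧ (D.tile i j).east = false) ∧
      ¬ ((D.tile i j).north = true ∧ (D.tile i j).south = false) := by
    intro i j h1 h2 h3
    rw [← Tile.eq_jelbow_iff, ← Tile.eq_jelbow_iff', and_self]
    intro h
    have := hmin i j h
    simp only [Fin.le_def, Fin.ext_iff] at *
    omega
  have hse' := Tile.eq_jelbow_iff.mp hse
  have hse'' := Tile.eq_jelbow_iff'.mp hse
  obtain ⟨j₁, hj, hj₁, hrow⟩ : ∃ j₁ < j₂, ¬ (D.tile i₂ j₁).west = true ∧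
      ∀ x, j₁ < x → x < j₂ → (D.tile i₂ x).west = true := by
    have hpos : (j₂ : ℕ) ≠ 0 := fun h => by simp [D.boundary_west i₂ j₂ h] at hse''
    exact Fin.exists_last_not (a := ⟨0, by omega⟩) (Nat.pos_of_ne_zero hpos)
      (by simp [D.boundary_west])
  obtain ⟨i₁, hi, hi₁, hcol⟩ : ∃ i₁ < i₂, ¬ (D.tile i₁ j₂).north = true ∧
      ∀ x, i₁ < x → x < i₂ → (D.tile x j₂).north = true := by
    have hpos : (i₂ : ℕ) ≠ 0 := fun h => by simp [D.boundary_north i₂ j₂ h] at hse'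
    exact Fin.exists_last_not (a := ⟨0, by omega⟩) (Nat.pos_of_ne_zero hpos)
      (by simp [D.boundary_north])
  have hbottom : ∀ j, j₁ ≤ j → j < j₂ → (D.tile i₂ j).east = true := by
    intro j h1 h2
    obtain ⟨k, hk⟩ : ∃ k : Fin n, (k : ℕ) = j + 1 := ⟨⟨j + 1, by
      simp only [Fin.lt_def] at h2; omega⟩, rfl⟩
    rw [D.match_horizontal i₂ j k hk]
    rcases (show k ≤ j₂ by simp only [Fin.lt_def, Fin.le_def] at *; omega).eq_or_lt with rfl | h3
    · exact hse''.1
    · exact hrow k (by simp only [Fin.lt_def, Fin.le_def] at *; omega) h3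
  have hright : ∀ i, i₁ ≤ i → i < i₂ → (D.tile i j₂).south = true := by
    intro i h1 h2
    obtain ⟨k, hk⟩ : ∃ k : Fin n, (k : ℕ) = i + 1 := ⟨⟨i + 1, by
      simp only [Fin.lt_def] at h2; omega⟩, rfl⟩
    rw [D.match_vertical i k j₂ hk]
    rcases (show k ≤ i₂ by simp only [Fin.lt_def, Fin.le_def] at *; omega).eq_or_lt with rfl | h3
    · exact hse'.1
    · exact hcol k (by simp only [Fin.lt_def, Fin.le_def] at *; omega) h3
  have hsw : D.tile i₂ j₁ = .relbow :=
    Tile.eq_relbow_iff'.mpr ⟨hbottom j₁ le_rfl hj, by simpa using hj₁⟩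
  have hne : D.tile i₁ j₂ = .relbow :=
    Tile.eq_relbow_iff.mpr ⟨hright i₁ le_rfl hi, by simpa using hi₁⟩
  -- Without j-elbows, a pipe on the first row would run into the west side of the NE corner.
  have htop : ∀ j, j₁ ≤ j → j < j₂ → (D.tile i₁ j).east = false := by
    intro j h1 h2
    obtain ⟨k, hk1, hk2, hk, hkw⟩ := D.west_eq_of_lt i₁ h2
    have hlast : (D.tile i₁ k).east = false := by
      rw [← hkw, hne]; rfl
    refine Fin.interval_induction_down (P := fun j => (D.tile i₁ j).east = false) hk1 hlast ?_
    intro x y hxy hx hy hP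
    rw [D.match_horizontal i₁ x y hxy]
    have := (hnoJ i₁ y hi.le (hy.trans hk2.le) (by simp [hi.ne])).1
    grind
  have hleft : ∀ i, i₁ ≤ i → i < i₂ → (D.tile i j₁).south = false := by
    intro i h1 h2
    obtain ⟨k, hk1, hk2, hk, hkn⟩ := D.north_eq_of_lt j₁ h2
    have hlast : (D.tile k j₁).south = false := by
      rw [← hkn, hsw]; rfl
    refine Fin.interval_induction_down (P := fun i => (D.tile i j₁).south = false) hk1 hlast ?_
    intro x y hxy hx hy hP
    rw [D.match_vertical x y j₁ hxy]
    have := (hnoJ y j₁ (hy.trans hk2.le) hj.le (by simp [hj.ne])).2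
    grind
  have hM : D.Movable i₁ i₂ j₁ j₂ := ⟨hi, hj, htop, hbottom, hleft, hright⟩
  have hnw : D.tile i₁ j₁ = .blank := by
    have h1 := htop j₁ le_rfl hj
    have h2 := hleft i₁ le_rfl hi
    have h3 := hnoJ i₁ j₁ hi.le hj.le (by simp [hi.ne])
    have hflow := (D.tile i₁ j₁).flow
    rw [Tile.eq_blank_iff]
    grind
  have hint : ∀ i j, i₁ < i → i < i₂ → j₁ < j → j < j₂ → ¬ (D.tile i j).IsElbow := by
    rintro i j h1 h2 h3 h4 (hR | hR)
    swap
    · exact (hnoJ i j h2.le h4.le (by simp [h2.ne])).1 (Tile.eq_jelbow_iff'.mp hR)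
    have hR' := Tile.eq_relbow_iff.mp hR
    have hR'' := Tile.eq_relbow_iff'.mp hR
    have hsouth : ∀ x, i ≤ x → x < i₂ → (D.tile x j).south = true := by
      intro x hx hx2
      refine Fin.interval_induction (P := fun x => (D.tile x j).south = true) hx hR'.1 ?_
      intro y z hyz hy hz hP
      rw [D.match_vertical y z j hyz] at hP
      have := (hnoJ z j (hz.trans hx2.le) h4.le (by simp [h4.ne])).2
      grind
    have hnorth : ∀ x, i < x → x ≤ i₂ → (D.tile x j).north = true := by
      intro x hx hx2
      obtain ⟨k, hk1, hk2, -, hk⟩ := D.north_eq_of_lt j hx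
      rw [hk, hsouth k hk1 (hk2.trans_le hx2)]
    have heast : ∀ x, j ≤ x → x < j₂ → (D.tile i x).east = true := by
      intro x hx hx2
      refine Fin.interval_induction (P := fun x => (D.tile i x).east = true) hx hR''.1 ?_
      intro y z hyz hy hz hP
      rw [D.match_horizontal i y z hyz] at hP
      have := (hnoJ i z h2.le (hz.trans hx2.le) (by simp [h2.ne])).1
      grind
    have hwest : ∀ x, j < x → x ≤ j₂ → (D.tile i x).west = true := by
      intro x hx hx2
      obtain ⟨k, hk1, hk2, -, hk⟩ := D.west_eq_of_lt i hx
      rw [hk, heast k hk1 (hk2.trans_le hx2)]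
    have hX₁ : D.tile i₂ j = .cross := by
      have h5 := hM.bottom j h3.le h4
      have h6 := hM.bottom_west j h3 h4.le
      have h7 := hnorth i₂ h2 le_rfl
      have hflow := (D.tile i₂ j).flow
      rw [Tile.eq_cross_iff]
      grind
    have hX₂ : D.tile i j₂ = .cross := by
      have h5 := hM.right i h1.le h2
      have h6 := hM.right_north i h1 h2.le
      have h7 := hwest j₂ h4 le_rfl
      have hflow := (D.tile i j₂).flow
      rw [Tile.eq_cross_iff]
      grind
    obtain ⟨p, hp⟩ := (D.exists_visits i₂ j₁).1 (Tile.eq_relbow_iff.mp hsw).1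
    obtain ⟨s, hs⟩ := (D.exists_visits i₂ j).1 (by rw [hX₁]; rfl)
    have hs' : D.Visits s i j .up := hs.up_run h2.le fun x hx hx2 => by
      rcases hx2.eq_or_lt with rfl | hx2
      · exact ⟨by rw [hX₁]; rfl, by rw [hX₁]; rfl⟩
      · exact ⟨hsouth x hx.le hx2, hnorth x hx hx2.le⟩
    obtain ⟨k, hk⟩ : ∃ k : Fin n, (k : ℕ) = j + 1 := ⟨⟨j + 1, by
      simp only [Fin.lt_def] at h4; omega⟩, rfl⟩
    have hs'' : D.Visits s i j₂ .right := by
      have hstart : D.Visits s i k .right := .right i j k _ hs' (by rw [hR]; rfl) hk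
      refine hstart.right_run (by simp only [Fin.lt_def, Fin.le_def] at *; omega) fun x hx hx2 => ?_
      have hx' : j < x := by simp only [Fin.lt_def, Fin.le_def] at *; omega
      exact ⟨hwest x hx' hx2.le, heast x hx'.le hx2⟩
    have hp₁ := hM.visits_bottom hsw hp h3 h4.le
    have hp₂ := hM.visits_right hsw hse hp h1.le h2
    have hne : s ≠ p := by
      rintro rfl
      simpa using hs.heading_unique hp₁
    have hc₁ : D.CrossAt s p (i₂, j) := ⟨hX₁, .inl ⟨hs, hp₁⟩⟩
    have hc₂ : D.CrossAt s p (i, j₂) := ⟨hX₂, .inr ⟨hp₂, hs''⟩⟩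
    exact h4.ne (Prod.ext_iff.mp (hD s p hne hc₁ hc₂)).2
  exact ⟨hM.move, hM.isReduced_move_of_undroop hD hnw hne hsw hse hint,
    hM.droop_move hnw hne hsw hse hint, hM.depth_move_lt⟩

/-! ### Flips of dreams without j-elbows -/

/-- A pipe heading right either stays in its row or reaches a j-elbow in that row and turns up. -/
theorem Reach.same_row_or_turn {a b i j : Fin n} {h : Heading}
    (hr : D.Reach a b .right i j h) :
    (i = a ∧ h = .right) ∨ ∃ c a' : Fin n, b ≤ c ∧ (a' : ℕ) + 1 = a ∧ D.tile a c = .jelbow ∧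
      (∀ x, b ≤ x → x ≤ c → (D.tile a x).west = true) ∧ D.Reach a' c .up i j h := by
  let I : Fin n → Fin n → Heading → Prop := fun i j h =>
    (i = a ∧ h = .right ∧ b ≤ j ∧ ∀ x, b ≤ x → x < j → (D.tile a x).west = true) ∨
    ∃ c a' : Fin n, b ≤ c ∧ (a' : ℕ) + 1 = a ∧ D.tile a c = .jelbow ∧
      (∀ x, b ≤ x → x ≤ c → (D.tile a x).west = true) ∧ D.Reach a' c .up i j h
  have hI : I i j h := by
    refine hr.invariant I (.inl ⟨rfl, rfl, le_rfl, fun x h1 h2 => absurd h2 h1.not_gt⟩) ?_ ?_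
    · rintro i i' j h (⟨rfl, rfl, hb, hw⟩ | ⟨c, a', h1, h2, h3, h4, h5⟩) he hi
      · have hJ := Tile.exit_right_eq_up.mp he
        refine .inr ⟨j, i', hb, hi, Tile.eq_jelbow_iff'.mpr hJ, fun x hx hx2 => ?_, .refl⟩
        rcases hx2.eq_or_lt with rfl | hx2
        · exact hJ.1
        · exact hw x hx hx2
      · exact .inr ⟨c, a', h1, h2, h3, h4, h5.tail (.up he hi)⟩
    · rintro i j j' h (⟨rfl, rfl, hb, hw⟩ | ⟨c, a', h1, h2, h3, h4, h5⟩) he hj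
      · refine .inl ⟨rfl, rfl, by simp only [Fin.le_def] at *; omega, fun x hx hx2 => ?_⟩
        rcases (show x ≤ j by simp only [Fin.lt_def, Fin.le_def] at *; omega).eq_or_lt with
          rfl | hx2
        · exact (Tile.exit_right_eq_right.mp he).1
        · exact hw x hx hx2
      · exact .inr ⟨c, a', h1, h2, h3, h4, h5.tail (.right he hj)⟩
  exact hI.imp (fun h => ⟨h.1, h.2.1⟩) id

/-- Two pipes that cross twice meet the two crossings in the same order. So a dream is reduced if a
pipe heading up and a pipe heading right through a crossing cannot meet again at a later one. -/
theorem isReduced_of_forall {D : BPD n}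
    (H : ∀ a b i j : Fin n, ∀ h h' : Heading, D.tile a b = .cross → D.tile i j = .cross →
      h ≠ h' → D.Reach a b .up i j h → D.Reach a b .right i j h' → i = a ∧ j = b) :
    D.IsReduced := by
  have key : ∀ p q a b i j h h', D.tile a b = .cross → D.tile i j = .cross → h ≠ h' →
      D.Visits p a b .up → D.Visits q a b .right → D.Visits p i j h → D.Visits q i j h' →
      (a, b) = (i, j) := by
    intro p q a b i j h h' hc hc' hh hp hq hp' hq'
    rcases hp.total hp' with hr | hr <;> rcases hq.total hq' with hr' | hr'
    · obtain ⟨rfl, rfl⟩ := H a b i j h h' hc hc' hh hr hr'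
      rfl
    · have h1 := hr.monotone
      have h2 := hr'.monotone
      exact Prod.ext (le_antisymm h2.1 h1.1) (le_antisymm h1.2.1 h2.2.1)
    · have h1 := hr.monotone
      have h2 := hr'.monotone
      exact Prod.ext (le_antisymm h1.1 h2.1) (le_antisymm h2.2.1 h1.2.1)
    · cases h <;> cases h' <;> simp only [ne_eq, not_true_eq_false] at hh
      · obtain ⟨rfl, rfl⟩ := H i j a b _ _ hc' hc (by decide) hr hr'
        rfl
      · obtain ⟨rfl, rfl⟩ := H i j a b _ _ hc' hc (by decide) hr' hr
        rfl
  rintro p q - ⟨a, b⟩ ⟨hc, h⟩ ⟨i, j⟩ ⟨hc', h'⟩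
  rcases h with ⟨hp, hq⟩ | ⟨hq, hp⟩ <;> rcases h' with ⟨hp', hq'⟩ | ⟨hq', hp'⟩
  · exact key p q a b i j _ _ hc hc' (by decide) hp hq hp' hq'
  · exact key p q a b i j _ _ hc hc' (by decide) hp hq hp' hq'
  · exact key q p a b i j _ _ hc hc' (by decide) hq hp hq' hp'
  · exact key q p a b i j _ _ hc hc' (by decide) hq hp hq' hp'

/-- A criterion for reducedness when the only j-elbows are at `(i₂, j₁)` and `(i₁, j₂)`, where
`i₂ = i₁ + 1` and `j₂ = j₁ + 1`, and the pipe through `(i₁, j₁)` runs up column `j₂` to row `i₀`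
without crossings. A pipe crossed twice by another one must turn at `(i₂, j₁)` in between, so the
second crossing is in row `i₀`; but the other pipe stays in a column to the left of `j₁` until it
heads right for good. -/
theorem isReduced_of_two_jelbows {i₀ i₁ i₂ j₁ j₂ : Fin n} (hi₀ : i₀ ≤ i₁)
    (hi : (i₂ : ℕ) = i₁ + 1) (hj : (j₂ : ℕ) = j₁ + 1)
    (hJ : ∀ i j, D.tile i j = .jelbow → (i = i₂ ∧ j = j₁) ∨ (i = i₁ ∧ j = j₂))
    (hnw : D.tile i₁ j₁ = .relbow)
    (hcol : ∀ i, i₀ < i → i ≤ i₁ → (D.tile i j₂).east = false)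
    (hturn : (D.tile i₀ j₂).north = false) :
    D.IsReduced := by
  refine isReduced_of_forall fun a b i j h h' hc hc' hh hp hq => ?_
  have hp_row : (i = a ∧ j = b) ∨ i < a := by
    have := hp.invariant (fun x y k => (x = a ∧ y = b ∧ k = .up) ∨ x < a) (.inl ⟨rfl, rfl, rfl⟩)
      (fun x x' y k hI _ hx => by simp only [Fin.lt_def, Fin.ext_iff] at *; omega)
      (fun x y y' k hI he hy => by
        rcases hI with ⟨rfl, rfl, rfl⟩ | hI
        · rw [hc] at he; simp [Tile.exit] at he
        · exact .inr hI)
    tauto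
  rcases hq.same_row_or_turn with ⟨rfl, -⟩ | ⟨c, a', hbc, ha', hJc, hw, hq'⟩
  · exact hp_row.resolve_right (lt_irrefl _)
  rcases hJ a c hJc with ⟨rfl, rfl⟩ | ⟨rfl, rfl⟩
  swap
  · -- The pipe enters the j-elbow `(i₁, j₂)` from the r-elbow to its left, right after turning.
    exfalso
    rcases hbc.eq_or_lt with rfl | hbc
    · simp [hc] at hJc
    · have := hw j₁ (by simp only [Fin.lt_def, Fin.le_def] at *; omega)
        (by simp only [Fin.le_def] at *; omega)
      simp [hnw, Tile.west] at this
  exfalso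
  obtain rfl : a' = i₁ := Fin.ext (by omega)
  have hbc : b < c := lt_of_le_of_ne hbc (by rintro rfl; simp [hc] at hJc)
  have hq_states : (i = a' ∧ j = c) ∨ (j = j₂ ∧ i₀ ≤ i ∧ i ≤ a') ∨
      (i = i₀ ∧ j₂ < j ∧ h' = .right) := by
    have := hq'.invariant (fun x y k => (x = a' ∧ y = c ∧ k = .up) ∨
      (y = j₂ ∧ i₀ ≤ x ∧ x ≤ a') ∨ (x = i₀ ∧ j₂ < y ∧ k = .right)) (.inl ⟨rfl, rfl, rfl⟩) ?_ ?_
    · tauto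
    · rintro x x' y k (⟨rfl, rfl, rfl⟩ | ⟨rfl, h1, h2⟩ | ⟨rfl, h1, rfl⟩) he hx
      · simp [hnw, Tile.exit] at he
      · have : x ≠ i₀ := by
          rintro rfl
          simp [Tile.north_of_exit he] at hturn
        refine .inr (.inl ⟨rfl, ?_, ?_⟩) <;>
        · simp only [Fin.le_def, Fin.ext_iff, ne_eq] at h1 h2 this ⊢
          omega
      · have := hJ _ _ (Tile.eq_jelbow_iff'.mpr (Tile.exit_right_eq_up.mp he))
        simp only [Fin.lt_def, Fin.le_def, Fin.ext_iff] at *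
        omega
    · rintro x y y' k (⟨rfl, rfl, rfl⟩ | ⟨rfl, h1, h2⟩ | ⟨rfl, h1, rfl⟩) he hy
      · simp only [Fin.lt_def, Fin.le_def, Fin.ext_iff] at *
        omega
      · have heast := Tile.east_of_exit he
        rcases h1.eq_or_lt with rfl | h1
        · exact .inr (.inr ⟨rfl, by simp only [Fin.lt_def]; omega, rfl⟩)
        · simp [hcol x h1 h2] at heast
      · exact .inr (.inr ⟨rfl, by simp only [Fin.lt_def] at *; omega, rfl⟩)
  have hp_up : h = .up → j = b := by
    have := hp.invariant (fun x y k => (k = .up ∧ y = b ∧ x ≤ a) ∨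
      (k = .right ∧ x < a ∧ ¬ (x = a' ∧ y = j₂))) (.inl ⟨rfl, rfl, le_rfl⟩) ?_ ?_
    · grind
    · rintro x x' y k (⟨rfl, rfl, h1⟩ | ⟨rfl, h1, h2⟩) he hx
      · exact .inl ⟨rfl, rfl, by simp only [Fin.le_def] at *; omega⟩
      · have := hJ _ _ (Tile.eq_jelbow_iff'.mpr (Tile.exit_right_eq_up.mp he))
        grind
    · rintro x y y' k (⟨rfl, rfl, h1⟩ | ⟨rfl, h1, h2⟩) he hy
      · -- A crossing passes the pipe straight up, so it does not head right before the next row.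
        refine .inr ⟨rfl, lt_of_le_of_ne h1 ?_, ?_⟩
        · rintro rfl
          simp [hc, Tile.exit] at he
        · simp only [Fin.lt_def, Fin.ext_iff] at *
          omega
      · refine .inr ⟨rfl, h1, ?_⟩
        rintro ⟨rfl, rfl⟩
        obtain rfl : y = c := Fin.ext (by omega)
        simp [hnw, Tile.exit] at he
  rcases hq_states with ⟨rfl, rfl⟩ | ⟨rfl, h1, h2⟩ | ⟨rfl, h1, rfl⟩
  · simp [hnw] at hc'
  · rw [Tile.eq_cross_iff] at hc'
    rcases h1.eq_or_lt with rfl | h1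
    · simp [hturn] at hc'
    · simp [hcol i h1 h2] at hc'
  · have := hp_up (by cases h <;> simp_all)
    simp only [Fin.lt_def, Fin.ext_iff] at *
    omega

/-- A dream without j-elbows that has an empty tile admits a flip to a reduced one. In the last
column with an empty tile, let `(i₀, j₁)` be the topmost one; the tile to its right is then an
r-elbow, whose pipe comes straight from below. The flip is at the lower end of the vertical run of
empty tiles that starts at `(i₀, j₁)`. -/
theorem exists_upFlip (hJ : ∀ i j, D.tile i j ≠ .jelbow) (hB : ∃ i j, D.tile i j = .blank) :
    ∃ D' : BPD n, D'.IsReduced ∧ D.UpFlip D' ∧ D'.depth < D.depth := by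
  classical
  obtain ⟨⟨i₃, j₁⟩, hb₃, hmax⟩ := (Finset.univ.filter fun c : Fin n × Fin n =>
    D.tile c.1 c.2 = .blank).exists_max_image Prod.snd
      (by obtain ⟨i, j, h⟩ := hB; exact ⟨(i, j), by simpa using h⟩)
  obtain ⟨i₀, hb₀, hmin⟩ := (Finset.univ.filter fun i : Fin n =>
    D.tile i j₁ = .blank).exists_min_image id ⟨i₃, by simpa using hb₃⟩
  simp only [Finset.mem_filter, Finset.mem_univ, true_and, Prod.forall, id] at hb₃ hmax hb₀ hmin
  have hJn : ∀ i j, (D.tile i j).north = true → (D.tile i j).south = true := fun i j h => by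
    by_contra hs
    exact hJ i j (Tile.eq_jelbow_iff.mpr ⟨h, by simpa using hs⟩)
  have hJw : ∀ i j, (D.tile i j).west = true → (D.tile i j).east = true := fun i j h => by
    by_contra hs
    exact hJ i j (Tile.eq_jelbow_iff'.mpr ⟨h, by simpa using hs⟩)
  have hb₀' := Tile.eq_blank_iff.mp hb₀
  obtain ⟨j₂, hj⟩ : ∃ j₂ : Fin n, (j₂ : ℕ) = j₁ + 1 := by
    by_cases h : (j₁ : ℕ) + 1 = n
    · simp [D.boundary_east i₀ j₁ h] at hb₀'
    · exact ⟨⟨j₁ + 1, by omega⟩, rfl⟩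
  have hj' : j₁ < j₂ := by simp only [Fin.lt_def]; omega
  have hw₀ : (D.tile i₀ j₂).west = false := by
    rw [← D.match_horizontal i₀ j₁ j₂ hj]; exact hb₀'.2.2.2
  -- Above the topmost empty tile, column `j₁` is horizontal, so a pipe in column `j₂` could not
  -- turn below the north side of the square.
  have habove : ∀ i, i < i₀ → (D.tile i j₁).south = false := by
    intro i h1
    obtain ⟨k, hk1, hk2, -, hk⟩ := D.north_eq_of_lt j₁ h1
    refine Fin.interval_induction_down (P := fun i => (D.tile i j₁).south = false) hk1
      (by rw [← hk]; exact hb₀'.1) ?_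
    intro x y hxy hx hy hP
    rw [D.match_vertical x y j₁ hxy]
    by_contra hn
    simp [hJn y j₁ (by simpa using hn)] at hP
  have hwest : ∀ i, i < i₀ → (D.tile i j₂).west = true := by
    intro i h1
    rw [← D.match_horizontal i j₁ j₂ hj]
    have h2 := habove i h1
    have h3 : D.tile i j₁ ≠ .blank := fun h => absurd (hmin i h) (not_le.mpr h1)
    have h4 := hJn i j₁
    have h5 := hJw i j₁
    have hflow := (D.tile i j₁).flow
    rw [ne_eq, Tile.eq_blank_iff] at h3
    grind
  have hturn : (D.tile i₀ j₂).north = false := by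
    by_contra hn
    have h0 : (0 : ℕ) < n := i₀.pos
    have := Fin.interval_induction_down (P := fun i => (D.tile i j₂).north = true)
      (a := ⟨0, h0⟩) (b := i₀) (by simp [Fin.le_def]) (by simpa using hn) (by
        intro x y hxy hx hy hP
        rw [← D.match_vertical x y j₂ hxy] at hP
        have h1 := hwest x (by simp only [Fin.lt_def, Fin.le_def] at *; omega)
        have h2 := hJw x j₂ h1
        have hflow := (D.tile x j₂).flow
        grind)
    simp [D.boundary_north ⟨0, h0⟩ j₂ rfl] at this
  have hs₀ : (D.tile i₀ j₂).south = true := by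
    have h3 : D.tile i₀ j₂ ≠ .blank := fun h => absurd (hmax _ _ h) (not_le.mpr hj')
    have hflow := (D.tile i₀ j₂).flow
    rw [ne_eq, Tile.eq_blank_iff] at h3
    grind
  have hrun : ∀ m, i₀ ≤ m → (∀ x, i₀ < x → x ≤ m → ¬ (D.tile x j₁).east = true) →
      D.tile m j₁ = .blank ∧ (D.tile m j₂).south = true := by
    intro m hm hx
    refine Fin.interval_induction (P := fun m => D.tile m j₁ = .blank ∧
      (D.tile m j₂).south = true) hm ⟨hb₀, hs₀⟩ ?_
    rintro x y hxy h1 h2 ⟨hP, hS⟩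
    have h3 := hx y (by simp only [Fin.lt_def, Fin.le_def] at *; omega) h2
    have h4 := D.match_vertical x y j₁ hxy
    rw [D.match_vertical x y j₂ hxy] at hS
    refine ⟨?_, hJn y j₂ hS⟩
    have hflow := (D.tile y j₁).flow
    rw [Tile.eq_blank_iff] at hP ⊢
    grind
  have hex : ∃ x, i₀ < x ∧ (D.tile x j₁).east = true := by
    by_contra! hno
    have hn : 0 < n := i₀.pos
    have hlast := (hrun ⟨n - 1, by omega⟩ (by simp only [Fin.le_def]; omega)
      (fun x hx _ => hno x hx)).1
    have := D.boundary_south ⟨n - 1, by omega⟩ j₁ (by simp; omega)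
    rw [hlast] at this
    simp [Tile.south] at this
  obtain ⟨x, hx, hxe⟩ := hex
  obtain ⟨i₂, hi₂, he₂, hfirst⟩ := Fin.exists_first (P := fun x => (D.tile x j₁).east = true) hx hxe
  obtain ⟨i₁, hi₁, -, hi, -⟩ := D.north_eq_of_lt j₁ hi₂
  have hi' : i₁ < i₂ := by simp only [Fin.lt_def]; omega
  have hrun' : ∀ m, i₀ ≤ m → m < i₂ → D.tile m j₁ = .blank ∧ (D.tile m j₂).south = true :=
    fun m h1 h2 => hrun m h1 fun x hx hxm => hfirst x hx (hxm.trans_lt h2)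
  have honly : ∀ i, i₁ ≤ i → i < i₂ → i = i₁ := fun i h1 h2 => by
    simp only [Fin.lt_def, Fin.le_def, Fin.ext_iff] at *; omega
  have honly' : ∀ j, j₁ ≤ j → j < j₂ → j = j₁ := fun j h1 h2 => by
    simp only [Fin.lt_def, Fin.le_def, Fin.ext_iff] at *; omega
  have hM : D.Movable i₁ i₂ j₁ j₂ := by
    obtain ⟨hb₁, hs₁⟩ := hrun' i₁ hi₁ hi'
    refine ⟨hi', hj', ?_, ?_, ?_, ?_⟩ <;> intro y h1 h2
    · rw [honly' y h1 h2, hb₁]; rfl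
    · rwa [honly' y h1 h2]
    · rw [honly y h1 h2, hb₁]; rfl
    · rwa [honly y h1 h2]
  refine ⟨hM.move, ?_, hM.upFlip_move hi.symm hj, hM.depth_move_lt⟩
  refine isReduced_of_two_jelbows hi₁ hi.symm hj ?_ ?_ ?_ ?_
  · intro i j h
    have h1 := hJ i j
    rw [Tile.eq_jelbow_iff, hM.move_north, hM.move_south] at h
    rw [ne_eq, Tile.eq_jelbow_iff] at h1
    grind
  · have := Tile.eq_blank_iff.mp (hrun' i₁ hi₁ hi').1
    rw [Tile.eq_relbow_iff, hM.move_north, hM.move_south]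
    grind
  · intro i h1 h2
    have hw : (D.tile i j₂).west = false := by
      rw [← D.match_horizontal i j₁ j₂ hj, (hrun' i h1.le (h2.trans_lt hi')).1]
      rfl
    have hs := (hrun' i h1.le (h2.trans_lt hi')).2
    obtain ⟨k, hk1, hk2, -, hk⟩ := D.north_eq_of_lt j₂ h1
    have hn := (hrun' k hk1 (hk2.trans (h2.trans_lt hi'))).2
    have hflow := (D.tile i j₂).flow
    rw [hM.move_east]
    grind
  · rw [hM.move_north]
    grind

end BPD

/-! ### The identity and connectedness -/

namespace BPD

variable {n : ℕ}

/-- The bumpless pipe dream with r-elbows on the diagonal and no other elbows. -/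
def identity (n : ℕ) : BPD n where
  tile i j := if i = j then .relbow else if i < j then .horiz else .vert
  match_horizontal i j j' hj := by
    simp only [Fin.ext_iff, Fin.lt_def]
    split_ifs <;> first | rfl | omega
  match_vertical i i' j hi := by
    simp only [Fin.ext_iff, Fin.lt_def]
    split_ifs <;> first | rfl | omega
  boundary_west i j hj := by
    simp only [Fin.ext_iff, Fin.lt_def]
    split_ifs <;> first | rfl | omega
  boundary_east i j hj := by
    simp only [Fin.ext_iff, Fin.lt_def]
    split_ifs <;> first | rfl | omega
  boundary_north i j hi := by
    simp only [Fin.ext_iff, Fin.lt_def]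
    split_ifs <;> first | rfl | omega
  boundary_south i j hi := by
    simp only [Fin.ext_iff, Fin.lt_def]
    split_ifs <;> first | rfl | omega

theorem identity_isReduced (n : ℕ) : (identity n).IsReduced := by
  rintro p q - c ⟨hc, -⟩
  simp only [identity] at hc
  split_ifs at hc

/-- Reading the tiles from the northwest, each one is determined by its north and west sides unless
it may be empty or a j-elbow. -/
theorem eq_of_no_blank_of_no_jelbow {D D' : BPD n} (hB : ∀ i j, D.tile i j ≠ .blank)
    (hJ : ∀ i j, D.tile i j ≠ .jelbow) (hB' : ∀ i j, D'.tile i j ≠ .blank)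
    (hJ' : ∀ i j, D'.tile i j ≠ .jelbow) : D = D' := by
  have key : ∀ k : ℕ, ∀ i j : Fin n, (i : ℕ) + j = k → D.tile i j = D'.tile i j := by
    intro k
    induction k using Nat.strong_induction_on with
    | _ k ih =>
      intro i j hk
      have hn : (D.tile i j).north = (D'.tile i j).north := by
        rcases Nat.eq_zero_or_pos i with h0 | h0
        · rw [D.boundary_north i j h0, D'.boundary_north i j h0]
        · have hi : (i : ℕ) = (⟨i - 1, by omega⟩ : Fin n) + 1 := by simp; omega
          rw [← D.match_vertical _ i j hi, ← D'.match_vertical _ i j hi,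
            ih _ (by simp; omega) ⟨i - 1, by omega⟩ j rfl]
      have hw : (D.tile i j).west = (D'.tile i j).west := by
        rcases Nat.eq_zero_or_pos j with h0 | h0
        · rw [D.boundary_west i j h0, D'.boundary_west i j h0]
        · have hj : (j : ℕ) = (⟨j - 1, by omega⟩ : Fin n) + 1 := by simp; omega
          rw [← D.match_horizontal i _ j hj, ← D'.match_horizontal i _ j hj,
            ih _ (by simp; omega) i ⟨j - 1, by omega⟩ rfl]
      have h1 := hB i j
      have h2 := hJ i j
      have h3 := hB' i j
      have h4 := hJ' i j
      cases h : D.tile i j <;> cases h' : D'.tile i j <;> simp_all [Tile.north, Tile.west]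
  ext i j
  exact key _ i j rfl

/-- Every reduced bumpless pipe dream other than the identity has an undroop or an upward flip to a
reduced one of smaller depth. -/
theorem IsReduced.exists_move {D : BPD n} (hD : D.IsReduced) (hne : D ≠ identity n) :
    ∃ D' : BPD n, D'.IsReduced ∧ (D.UpFlip D' ∨ D.Undroop D') ∧ D'.depth < D.depth := by
  by_cases hJ : ∃ i j, D.tile i j = .jelbow
  · obtain ⟨D', h1, h2, h3⟩ := hD.exists_undroop hJ
    exact ⟨D', h1, .inr h2, h3⟩
  push Not at hJ
  by_cases hB : ∃ i j, D.tile i j = .blank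
  · obtain ⟨D', h1, h2, h3⟩ := exists_upFlip hJ hB
    exact ⟨D', h1, .inl h2, h3⟩
  push Not at hB
  refine absurd (eq_of_no_blank_of_no_jelbow hB hJ (fun i j h => ?_) (fun i j h => ?_)) hne <;>
  · simp only [identity] at h
    split_ifs at h

end BPD

theorem rbpdGraph_reachable_identity {n : ℕ} (D : RBPD n) :
    (rbpdGraph n).Reachable D ⟨BPD.identity n, BPD.identity_isReduced n⟩ := by
  induction hk : D.1.depth using Nat.strong_induction_on generalizing D with
  | _ k ih =>
    by_cases hne : D.1 = BPD.identity n
    · rw [show D = ⟨BPD.identity n, BPD.identity_isReduced n⟩ from Subtype.ext hne]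
      exact .rfl
    · obtain ⟨D', hD', hmove, hlt⟩ := D.2.exists_move hne
      have hadj : (rbpdGraph n).Adj D ⟨D', hD'⟩ :=
        (SimpleGraph.fromRel_adj _ _ _).mpr
          ⟨fun h => hlt.ne (congrArg (fun E : RBPD n => E.1.depth) h).symm,
            .inl (hmove.imp .inl .inr)⟩
      exact hadj.reachable.trans (ih _ (hk ▸ hlt) ⟨D', hD'⟩ rfl)

theorem mainTheorem2 (n : ℕ) : (rbpdGraph n).Connected where
  preconnected D D' :=
    (rbpdGraph_reachable_identity D).trans (rbpdGraph_reachable_identity D').symm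
  nonempty := ⟨⟨BPD.identity n, BPD.identity_isReduced n⟩⟩
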